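/- Let $N\ge 1$, $d\ge 0$ be integers, and let $L^{(1)},\dots,L^{(N)}$ be independent two-sided scalar Lévy processes (with $L^{(j)}_0=0$, stationary independent increments on $\mathbb{R}$ and càdlàg paths) on a probability space $(\Omega,\mathcal F,\mathbb P)$ with $\mathbb E|L^{(j)}_1|<\infty$. Let $c_j\in\mathbb R^d$ and let $$\bar X^{(j)}_t=c_j e^{-t}\int_{-\infty}^t e^{s}\,dL^{(j)}_s=c_j\Big(L^{(j)}_t-e^{-t}\int_{-\infty}^t e^{s}L^{(j)}_s\,ds\Big)$$ be the stationary solutions of the Langevin equations $dX=-X\,dt+c_j\,dL^{(j)}$. Let $f^{(j)}:\mathbb R^d\to\mathbb R^d$, $j=1,\dots,N$, be such that (i) for some $l>4$, $\langle x_1-x_2,f^{(j)}(x_1)-f^{(j)}(x_2)\rangle\le -l\|x_1-x_2\|^2$ for all $x_1,x_2\in\mathbb R^d$ and all $j$; (ii) there is $m_0>0$ such that $\int_{-\infty}^t e^{ms}\|f^{(j)}(X(s))\|^2\,ds<\infty$ for all $j$, all $m\in(0,m_0]$, all $t\in\mathbb R$ and every càdlàg $X:\mathbb R\to\mathbb R^d$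 of sub-exponential growth (that is, $e^{-\varepsilon|s|}\|X(s)\|\to0$ as $|s|\to\infty$ for every $\varepsilon>0$). Let $t_0\in\mathbb R$ and suppose that, for almost every $\omega$ and all $\lambda>0$, $(x^{(1)}_\lambda,\dots,x^{(N)}_\lambda)$ is a continuous solution on $[t_0,\infty)$ of the coupled random differential equations (right-hand derivative in time) $$\frac{dx^{(j)}}{dt_+}=f^{(j)}\big(x^{(j)}+\bar X^{(j)}_t\big)+x^{(j)}+\bar X^{(j)}_t+\lambda\big(x^{(j-1)}-2x^{(j)}+x^{(j+1)}\big),\qquad j=1,\dots,N,$$ with $x^{(0)}=x^{(N)}$ and $x^{(N+1)}=x^{(1)}$, whose initial values $x^{(j)}_\lambda(t_0,\omega)$ stay bounded as $\lambda\to\infty$ for almost every $\omega$ (in particular, they may be given random vectors $x^{(j)}_0(\omega)$ that do not depend on $\lambda$, at time $t_0=0$). Then for almost every $\omega$, for all $t_0<T_1\le T_2<\infty$ and all $j,k\in\{1,\dots,N\}$, $$\lim_{\lambda\to\infty}\ \sup_{t\in[T_1,T_2]}\big\|x^{(j)}_\lambda(t,\omega)-x^{(k)}_\lambda(t,\omega)\big\|=0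 .$$ -/

import Mathlib

open MeasureTheory ProbabilityTheory Filter Set Topology

/-- A path `ℝ → E` is càdlàg: right-continuous with (finite) left limits at every time. -/
def IsCadlagPath {E : Type*} [TopologicalSpace E] (X : ℝ → E) : Prop :=
  ∀ t : ℝ, ContinuousWithinAt X (Ici t) t ∧ ∃ y : E, Tendsto X (𝓝[<] t) (𝓝 y)

/-- Sub-exponential growth: `e^{-ε|s|} ‖X s‖ → 0` as `|s| → ∞`, for every `ε > 0`. -/
def HasSubexponentialGrowth {E : Type*} [NormedAddCommGroup E] (X : ℝ → E) : Prop :=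
  ∀ ε : ℝ, 0 < ε → Tendsto (fun s : ℝ => Real.exp (-ε * |s|) * ‖X s‖) (atBot ⊔ atTop) (𝓝 0)

/-- The one-sided dissipative Lipschitz condition with constant `l`. -/
def OneSidedDissipative {d : ℕ}
    (f : EuclideanSpace ℝ (Fin d) → EuclideanSpace ℝ (Fin d)) (l : ℝ) : Prop :=
  ∀ x₁ x₂ : EuclideanSpace ℝ (Fin d), inner ℝ (x₁ - x₂) (f x₁ - f x₂) ≤ -l * ‖x₁ - x₂‖ ^ 2

/-- The integrability condition with constant `m₀`: for every `m ∈ (0, m₀]`, every càdlàg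
`X : ℝ → ℝ^d` of sub-exponential growth and every `t`, the integral of `e^{ms} ‖f (X s)‖²` over
`(-∞, t]` is finite. -/
def IntegrabilityCondition {d : ℕ}
    (f : EuclideanSpace ℝ (Fin d) → EuclideanSpace ℝ (Fin d)) (m₀ : ℝ) : Prop :=
  ∀ m : ℝ, 0 < m → m ≤ m₀ → ∀ X : ℝ → EuclideanSpace ℝ (Fin d),
    IsCadlagPath X → HasSubexponentialGrowth X →
      ∀ t : ℝ, ∫⁻ s in Iic t, ENNReal.ofReal (Real.exp (m * s) * ‖f (X s)‖ ^ 2) < ⊤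

/-- A two-sided scalar Lévy process: it starts at zero, it has independent and stationary
increments over the whole time axis, and almost all of its paths are càdlàg. -/
structure IsTwoSidedLevyProcess {Ω : Type*} [MeasurableSpace Ω] (L : ℝ → Ω → ℝ)
    (P : Measure Ω) : Prop where
  measurable : ∀ t : ℝ, Measurable (L t)
  zero : ∀ᵐ ω ∂P, L 0 ω = 0
  indep_increments : HasIndepIncrements L P
  stationary_increments : ∀ s h : ℝ, 0 ≤ h →
    IdentDistrib (fun ω => L (s + h) ω - L s ω) (fun ω => L h ω - L 0 ω) P P
  cadlag : ∀ᵐ ω ∂P, IsCadlagPath (fun t : ℝ => L t ω)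

/-- The pathwise integral `∫_{-∞}^t e^s dℓ(s)` of the smooth integrand `e^s` against a càdlàg path
`ℓ` of sub-exponential growth, i.e. (integrating by parts on `[a, t]` and letting `a → -∞`)
`e^t ℓ(t) - ∫_{-∞}^t e^s ℓ(s) ds`. -/
noncomputable def expStieltjesIntegral (ℓ : ℝ → ℝ) (t : ℝ) : ℝ :=
  Real.exp t * ℓ t - ∫ s in Iic t, Real.exp s * ℓ s

/-- The stationary Ornstein-Uhlenbeck process `c e^{-t} ∫_{-∞}^t e^s dL_s`, which solves the
Langevin equation `dX = -X dt + c dL`. -/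
noncomputable def ouProcess {Ω : Type*} {d : ℕ} (c : EuclideanSpace ℝ (Fin d)) (L : ℝ → Ω → ℝ)
    (t : ℝ) (ω : Ω) : EuclideanSpace ℝ (Fin d) :=
  (Real.exp (-t) * expStieltjesIntegral (fun s => L s ω) t) • c

/-- `x`, restricted to `[t₀, ∞)`, is a (continuous) solution of the ring of `N` coupled equations
`dx_j/dt_+ = F_j(x_j, Xbar_j) + lam (x_{j-1} - 2 x_j + x_{j+1})` with
`F_j(x, y) = f_j(x + y) + x + y`; the derivative in time is the right-hand derivative, and the
indices are cyclic (addition in `Fin N` is modulo `N`). -/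
def IsCoupledSolution {N d : ℕ} [NeZero N]
    (f : Fin N → EuclideanSpace ℝ (Fin d) → EuclideanSpace ℝ (Fin d))
    (Xbar : Fin N → ℝ → EuclideanSpace ℝ (Fin d)) (lam t₀ : ℝ)
    (x : Fin N → ℝ → EuclideanSpace ℝ (Fin d)) : Prop :=
  ∀ j : Fin N, ContinuousOn (x j) (Ici t₀) ∧
    ∀ t : ℝ, t₀ ≤ t →
      HasDerivWithinAt (x j)
        (f j (x j t + Xbar j t) + x j t + Xbar j t
          + lam • (x (j - 1) t - (2 : ℝ) • x j t + x (j + 1) t)) (Ici t) t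

/-! ### Local boundedness of dissipative maps and of càdlàg paths

Synchronization on compact time intervals only needs the nonlinearities and the driving paths to be
locally bounded. For the former this follows from the dissipativity alone, for the latter from the
càdlàg property, so neither the growth of the paths at `-∞` nor the integrability condition enters.
-/

/-! The argument is pathwise, on `[t₀, T₂]`, where the driving paths are bounded. The coupling can
only lower the total energy `∑ ‖x j‖²`, and dissipativity bounds the growth due to the rest, so the
solutions are bounded by some `M` independent of large `lam` (`sum_norm_sq_le_of_inner_le`).
Dissipative maps are bounded on balls (`OneSidedDissipative.exists_norm_le`), hence the forcing
along the solutions is bounded uniformly in `lam` too.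

The disagreement `Q = ∑ ∑ ‖x j - x k‖²` then satisfies `Q' ≤ -(4 lam / N³) Q + const`, by the
Poincaré inequality on the cycle (`sum_sum_norm_sub_sq_le`). Grönwall bounds `Q` by a transient of
order `exp (-4 lam (t - t₀) / N³)` plus `O(1 / lam)`, which vanishes uniformly for `t ≥ T₁ > t₀`. -/

/-- An everywhere defined dissipative map on a finite-dimensional space is bounded on balls. -/
theorem OneSidedDissipative.exists_norm_le {d : ℕ}
    {f : EuclideanSpace ℝ (Fin d) → EuclideanSpace ℝ (Fin d)} {l : ℝ} (hl : 0 ≤ l)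
    (hf : OneSidedDissipative f l) {r : ℝ} (hr : 0 ≤ r) :
    ∃ C : ℝ, 0 ≤ C ∧ ∀ x, ‖x‖ ≤ r → ‖f x‖ ≤ C := by
  -- The test points will be `±R eᵢ`. Summing over the `d` coordinates costs `d * r * S`; this `R`
  -- absorbs it and leaves the factor `R - d * r = 1`.
  set R : ℝ := d * r + 1 with hR
  have hR0 : 0 ≤ R := by positivity
  let p : Fin d → EuclideanSpace ℝ (Fin d) := fun i => EuclideanSpace.single i R
  set C₀ : ℝ := ∑ i, (‖f (p i)‖ + ‖f (-p i)‖) with hC₀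
  have hC₀0 : 0 ≤ C₀ := by positivity
  have hle (i : Fin d) : ‖f (p i)‖ ≤ C₀ ∧ ‖f (-p i)‖ ≤ C₀ := by
    have := Finset.single_le_sum (f := fun i => ‖f (p i)‖ + ‖f (-p i)‖)
      (fun i _ => by positivity) (Finset.mem_univ i)
    exact ⟨by linarith [norm_nonneg (f (-p i))], by linarith [norm_nonneg (f (p i))]⟩
  have hp (i : Fin d) : ‖p i‖ ≤ R := by simp [p, abs_of_nonneg hR0]
  -- Monotonicity between `x` and `z` gives `-⟨z, f x⟩ ≤ ⟨x - z, f z⟩ - ⟨x, f x⟩`; taking `z = ±R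
  -- eᵢ` isolates a coordinate of `f x`.
  have key (x z : EuclideanSpace ℝ (Fin d)) (hx : ‖x‖ ≤ r) (hz : ‖z‖ ≤ R) (hfz : ‖f z‖ ≤ C₀) :
      -inner ℝ z (f x) ≤ (r + R) * C₀ + r * ‖f x‖ := by
    have h1 := hf x z
    have h2 : inner ℝ (x - z) (f z) ≤ (r + R) * C₀ :=
      (real_inner_le_norm _ _).trans <| mul_le_mul ((norm_sub_le _ _).trans (add_le_add hx hz)) hfz
        (norm_nonneg _) (by positivity)
    have h3 : -inner ℝ x (f x) ≤ r * ‖f x‖ :=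
      (neg_le_abs _).trans <| (abs_real_inner_le_norm _ _).trans <| by gcongr
    have h4 : 0 ≤ l * ‖x - z‖ ^ 2 := by positivity
    simp only [inner_sub_left, inner_sub_right] at h1 h2
    linarith
  refine ⟨d * ((r + R) * C₀), by positivity, fun x hx => ?_⟩
  set S : ℝ := ∑ i, ‖f x i‖ with hS
  have hfS : ‖f x‖ ≤ S := by
    have h : f x = ∑ i, EuclideanSpace.single i (f x i) := by
      ext i
      simp [Finset.sum_apply, Pi.single_apply]
    calc ‖f x‖ = ‖∑ i, EuclideanSpace.single i (f x i)‖ := by rw [← h]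
      _ ≤ ∑ i, ‖EuclideanSpace.single i (f x i)‖ := norm_sum_le _ _
      _ = S := by simp [hS]
  have hi (i : Fin d) : R * ‖f x i‖ ≤ (r + R) * C₀ + r * ‖f x‖ := by
    have h1 := key x (p i) hx (hp i) (hle i).1
    have h2 := key x (-p i) hx (by rw [norm_neg]; exact hp i) (hle i).2
    simp only [inner_neg_left, p, EuclideanSpace.inner_single_left] at h1 h2
    simp only [conj_trivial] at h1 h2
    rcases abs_cases (f x i) with h | h <;> rw [Real.norm_eq_abs, h.1] <;> linarith
  have hsum : R * S ≤ d * ((r + R) * C₀ + r * ‖f x‖) := by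
    rw [hS, Finset.mul_sum]
    refine (Finset.sum_le_sum fun i _ => hi i).trans ?_
    simp [mul_add]
  have : (d : ℝ) * (r * ‖f x‖) ≤ d * (r * S) := by gcongr
  have : (R - d * r) * S ≤ d * ((r + R) * C₀) := by linarith
  rw [hR, add_sub_cancel_left, one_mul] at this
  rw [hR]
  exact hfS.trans this

/-- A càdlàg path is bounded on compact intervals. -/
theorem IsCadlagPath.exists_norm_le {E : Type*} [NormedAddCommGroup E] {X : ℝ → E}
    (hX : IsCadlagPath X) (a b : ℝ) : ∃ C : ℝ, 0 ≤ C ∧ ∀ t ∈ Icc a b, ‖X t‖ ≤ C := by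
  suffices h : ∃ C : ℝ, ∀ t ∈ Icc a b, ‖X t‖ ≤ C by
    obtain ⟨C, hC⟩ := h
    exact ⟨max C 0, le_max_right _ _, fun t ht => (hC t ht).trans (le_max_left _ _)⟩
  refine isCompact_Icc.induction_on (p := fun s : Set ℝ => ∃ C : ℝ, ∀ t ∈ s, ‖X t‖ ≤ C)
    ⟨0, by simp⟩ (fun s t hst ⟨C, hC⟩ => ⟨C, fun u hu => hC u (hst hu)⟩) ?_ fun t _ => ?_
  · rintro s t ⟨C, hC⟩ ⟨D, hD⟩
    refine ⟨max C D, fun u hu => ?_⟩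
    exact hu.elim (fun h => (hC u h).trans (le_max_left _ _))
      fun h => (hD u h).trans (le_max_right _ _)
  · obtain ⟨hr, y, hy⟩ := hX t
    have h1 : ∀ᶠ u in 𝓝[≥] t, ‖X u‖ ≤ max (‖X t‖ + 1) (‖y‖ + 1) :=
      (hr.norm.eventually_lt_const (lt_add_one _)).mono fun u hu => hu.le.trans (le_max_left _ _)
    have h2 : ∀ᶠ u in 𝓝[<] t, ‖X u‖ ≤ max (‖X t‖ + 1) (‖y‖ + 1) :=
      (hy.norm.eventually_lt_const (lt_add_one _)).mono fun u hu => hu.le.trans (le_max_right _ _)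
    have h3 : ∀ᶠ u in 𝓝 t, ‖X u‖ ≤ max (‖X t‖ + 1) (‖y‖ + 1) := by
      rw [← nhdsLT_sup_nhdsGE]
      exact eventually_sup.2 ⟨h2, h1⟩
    exact ⟨_, mem_nhdsWithin_of_mem_nhds h3, _, fun u hu => hu⟩

/-- The integral of a locally bounded function over `Iic t` is locally bounded in `t`. -/
theorem exists_norm_setIntegral_Iic_le {g : ℝ → ℝ} {a b C : ℝ}
    (hg : ∀ t ∈ Icc a b, ‖g t‖ ≤ C) :
    ∃ D : ℝ, ∀ t ∈ Icc a b, ‖∫ s in Iic t, g s‖ ≤ D := by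
  refine ⟨‖∫ s in Iic a, g s‖ + |C| * (b - a), fun t ht => ?_⟩
  have hab : a ≤ b := ht.1.trans ht.2
  by_cases hint : IntegrableOn g (Iic t)
  · have hsplit : ∫ s in Iic t, g s = (∫ s in Iic a, g s) + ∫ s in Ioc a t, g s := by
      rw [← Iic_union_Ioc_eq_Iic ht.1]
      exact setIntegral_union (Iic_disjoint_Ioc le_rfl) measurableSet_Ioc
        (hint.mono_set (Iic_subset_Iic.2 ht.1)) (hint.mono_set Ioc_subset_Iic_self)
    have hIoc : ‖∫ s in Ioc a t, g s‖ ≤ |C| * volume.real (Ioc a t) :=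
      norm_setIntegral_le_of_norm_le_const (by simp) fun s hs =>
        (hg s ⟨hs.1.le, hs.2.trans ht.2⟩).trans (le_abs_self C)
    rw [Real.volume_real_Ioc_of_le ht.1] at hIoc
    rw [hsplit]
    refine (norm_add_le _ _).trans (add_le_add le_rfl (hIoc.trans ?_))
    have := ht.2
    gcongr
  -- Without integrability the integral has the default value `0`, so no growth condition at `-∞` is
  -- needed.
  · rw [integral_undef hint, norm_zero]
    have := sub_nonneg.2 hab
    positivity

/-- The Ornstein-Uhlenbeck process driven by a càdlàg path is bounded on compact intervals. -/
theorem exists_norm_ornsteinUhlenbeck_le {Ω : Type*} {d : ℕ} (c : EuclideanSpace ℝ (Fin d))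
    {L : ℝ → Ω → ℝ} {ω : Ω} (hL : IsCadlagPath fun t => L t ω) (a b : ℝ) :
    ∃ C : ℝ, 0 ≤ C ∧ ∀ t ∈ Icc a b, ‖(ouProcess c L t ω)‖ ≤ C := by
  obtain ⟨B, hB0, hB⟩ := hL.exists_norm_le a b
  have hexp : ∀ t ∈ Icc a b, ‖Real.exp t * L t ω‖ ≤ Real.exp b * B := fun t ht => by
    rw [norm_mul, Real.norm_eq_abs (Real.exp t), Real.abs_exp]
    have := ht.2
    have := hB t ht
    gcongr
  obtain ⟨D, hD⟩ := exists_norm_setIntegral_Iic_le hexp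
  refine ⟨Real.exp (-a) * (Real.exp b * B + |D|) * ‖c‖, by positivity, fun t ht => ?_⟩
  rw [ouProcess, norm_smul, norm_mul, Real.norm_eq_abs (Real.exp _), Real.abs_exp,
    expStieltjesIntegral]
  have h1 : ‖Real.exp t * L t ω - ∫ s in Iic t, Real.exp s * L s ω‖ ≤ Real.exp b * B + |D| :=
    (norm_sub_le _ _).trans (add_le_add (hexp t ht) ((hD t ht).trans (le_abs_self D)))
  have := ht.1
  gcongr

/-! ### Quadratic forms on the cycle -/

section Cycle

variable {E : Type*} [NormedAddCommGroup E] [InnerProductSpace ℝ E] {N : ℕ} [NeZero N]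

/-- The second difference on the cycle. -/
def cycleLaplacian (x : Fin N → E) (j : Fin N) : E := x (j - 1) - (2 : ℝ) • x j + x (j + 1)

theorem sum_add_one {M : Type*} [AddCommMonoid M] (g : Fin N → M) :
    ∑ j, g (j + 1) = ∑ j, g j :=
  Equiv.sum_comp (Equiv.addRight (1 : Fin N)) g

theorem sum_sub_one {M : Type*} [AddCommMonoid M] (g : Fin N → M) :
    ∑ j, g (j - 1) = ∑ j, g j :=
  Equiv.sum_comp (Equiv.subRight (1 : Fin N)) g

/-- The coupling preserves the mean of the components; this removes the last term of
`sum_sum_inner_sub`. -/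
theorem sum_cycleLaplacian (x : Fin N → E) : ∑ j, cycleLaplacian x j = 0 := by
  simp only [cycleLaplacian, Finset.sum_add_distrib, Finset.sum_sub_distrib, sum_add_one,
    sum_sub_one, two_smul]
  abel

/-- Summation by parts on a cycle, which has no boundary terms. The sign makes the coupling
dissipative. -/
theorem sum_inner_cycleLaplacian (x : Fin N → E) :
    ∑ j, inner ℝ (x j) (cycleLaplacian x j) = -∑ j, ‖x j - x (j + 1)‖ ^ 2 := by
  have h1 : ∑ j, inner ℝ (x j) (x (j - 1)) = ∑ j, inner ℝ (x j) (x (j + 1)) := by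
    rw [← sum_add_one fun j => inner ℝ (x j) (x (j - 1))]
    refine Finset.sum_congr rfl fun j _ => ?_
    rw [add_sub_cancel_right, real_inner_comm]
  have h2 : ∑ j, ‖x (j + 1)‖ ^ 2 = ∑ j, ‖x j‖ ^ 2 := sum_add_one fun j => ‖x j‖ ^ 2
  simp only [cycleLaplacian, inner_add_right, inner_sub_right, inner_smul_right,
    Finset.sum_add_distrib, Finset.sum_sub_distrib, ← Finset.mul_sum, norm_sub_sq_real,
    real_inner_self_eq_norm_sq, h1, h2]
  ring

/-- Converts the all-pairs form, in which disagreement is measured, into the diagonal form where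
summation by parts applies. -/
theorem sum_sum_inner_sub {N : ℕ} (x y : Fin N → E) :
    ∑ j, ∑ k, inner ℝ (x j - x k) (y j - y k) =
      2 * N * ∑ j, inner ℝ (x j) (y j) - 2 * inner ℝ (∑ j, x j) (∑ j, y j) := by
  simp only [inner_sub_left, inner_sub_right, Finset.sum_sub_distrib, Finset.sum_const,
    Finset.card_univ, Fintype.card_fin, nsmul_eq_mul, ← Finset.mul_sum, ← inner_sum, ← sum_inner]
  ring

/-- The Poincaré inequality on the cycle. -/
theorem sum_sum_norm_sub_sq_le {E : Type*} [NormedAddCommGroup E] (x : Fin N → E) :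
    ∑ j, ∑ k, ‖x j - x k‖ ^ 2 ≤ (N : ℝ) ^ 4 * ∑ j, ‖x j - x (j + 1)‖ ^ 2 := by
  set D : ℝ := ∑ j, ‖x j - x (j + 1)‖ ^ 2 with hD
  have hD0 : 0 ≤ D := by positivity
  have hstep (j : Fin N) : ‖x j - x (j + 1)‖ ≤ √D :=
    Real.le_sqrt_of_sq_le <| Finset.single_le_sum (f := fun j => ‖x j - x (j + 1)‖ ^ 2)
      (fun j _ => by positivity) (Finset.mem_univ j)
  have hpath (n : ℕ) (j : Fin N) : ‖x j - x (j + Fin.ofNat N n)‖ ≤ n * √D := by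
    induction n with
    | zero => simp
    | succ n ih =>
      have h : j + Fin.ofNat N (n + 1) = j + Fin.ofNat N n + 1 := by
        rw [add_assoc]
        congr 1
        ext
        simp [Fin.val_add]
      rw [h, ← sub_add_sub_cancel _ (x (j + Fin.ofNat N n)) _]
      refine (norm_add_le _ _).trans ?_
      push_cast
      rw [add_mul, one_mul]
      exact add_le_add ih (hstep _)
  -- Fewer than `N` edges lead from `j` to `k`, each of length at most `√D`; the `N²` pairs then
  -- produce `N⁴`.
  have hpair (j k : Fin N) : ‖x j - x k‖ ^ 2 ≤ (N : ℝ) ^ 2 * D := by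
    have h := hpath (k - j).val j
    rw [Fin.ofNat_val_eq_self, add_sub_cancel] at h
    have h2 : ‖x j - x k‖ ≤ N * √D := h.trans <| by
      have := (k - j).isLt.le
      gcongr
    calc ‖x j - x k‖ ^ 2 ≤ (N * √D) ^ 2 := by gcongr
      _ = (N : ℝ) ^ 2 * D := by rw [mul_pow, Real.sq_sqrt hD0]
  refine (Finset.sum_le_sum fun j _ => Finset.sum_le_sum fun k _ => hpair j k).trans ?_
  simp only [Finset.sum_const, Finset.card_univ, Fintype.card_fin, nsmul_eq_mul]
  exact le_of_eq (by ring)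

/-! ### Energy estimates -/

/-- Grönwall's inequality for right derivatives, with a constant of arbitrary sign. -/
theorem le_gronwallBound_of_deriv_right_le {g g' : ℝ → ℝ} {δ K ε a b : ℝ}
    (hg : ContinuousOn g (Icc a b)) (hg' : ∀ t ∈ Ico a b, HasDerivWithinAt g (g' t) (Ici t) t)
    (ha : g a ≤ δ) (bound : ∀ t ∈ Ico a b, g' t ≤ K * g t + ε) :
    ∀ t ∈ Icc a b, g t ≤ gronwallBound δ K ε (t - a) :=
  le_gronwallBound_of_liminf_deriv_right_le hg
    (fun t ht _ hr => (hg' t ht).liminf_right_slope_le hr) ha bound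

variable {x b : Fin N → ℝ → E} {lam a T : ℝ}

/-- If the forcing `b` is dissipative up to a bounded error, the total energy of the coupled system
grows at most linearly, uniformly in the coupling strength. -/
theorem sum_norm_sq_le_of_inner_le {C : ℝ} (hlam : 0 ≤ lam)
    (hx : ∀ j, ContinuousOn (x j) (Icc a T))
    (hx' : ∀ j, ∀ t ∈ Ico a T,
      HasDerivWithinAt (x j) (b j t + lam • cycleLaplacian (x · t) j) (Ici t) t)
    (hb : ∀ j, ∀ t ∈ Ico a T, inner ℝ (x j t) (b j t) ≤ C) :
    ∀ t ∈ Icc a T, ∑ j, ‖x j t‖ ^ 2 ≤ ∑ j, ‖x j a‖ ^ 2 + 2 * N * C * (t - a) := by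
  have h := le_gronwallBound_of_deriv_right_le (g := fun t => ∑ j, ‖x j t‖ ^ 2)
    (δ := ∑ j, ‖x j a‖ ^ 2) (K := 0) (ε := 2 * N * C)
    (continuousOn_finsetSum _ fun j _ => (hx j).norm.pow 2)
    (fun t ht => HasDerivWithinAt.fun_sum fun j _ => (hx' j t ht).norm_sq) le_rfl
    fun t ht => ?_
  · simpa [gronwallBound_K0] using h
  · have h1 : ∑ j, inner ℝ (x j t) (b j t) ≤ N * C := by
      simpa using Finset.sum_le_sum fun j (_ : j ∈ Finset.univ) => hb j t ht
    have h2 := sum_inner_cycleLaplacian (x · t)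
    -- The coupling enters the derivative as minus twice this quantity, so dropping it makes the
    -- bound independent of `lam`.
    have h3 : 0 ≤ lam * ∑ j, ‖x j t - x (j + 1) t‖ ^ 2 := by positivity
    simp only [inner_add_right, inner_smul_right, ← Finset.mul_sum, Finset.sum_add_distrib, h2]
    linarith

/-- If the forcing `b` and the solution are bounded, the disagreement between the components of the
coupled system is damped at a rate proportional to the coupling strength. -/
theorem sum_sum_norm_sub_sq_le_of_norm_le {M K : ℝ} (hlam : 0 < lam) (hM : 0 ≤ M)
    (hx : ∀ j, ContinuousOn (x j) (Icc a T))
    (hx' : ∀ j, ∀ t ∈ Ico a T,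
      HasDerivWithinAt (x j) (b j t + lam • cycleLaplacian (x · t) j) (Ici t) t)
    (hxM : ∀ j, ∀ t ∈ Icc a T, ‖x j t‖ ≤ M) (hbK : ∀ j, ∀ t ∈ Icc a T, ‖b j t‖ ≤ K) :
    ∀ t ∈ Icc a T, ∑ j, ∑ k, ‖x j t - x k t‖ ^ 2 ≤
      gronwallBound (4 * N ^ 2 * M ^ 2) (-(4 / N ^ 3 * lam)) (8 * N ^ 2 * M * K) (t - a) := by
  have hN : (0 : ℝ) < N := Nat.cast_pos.2 (NeZero.pos N)
  intro t₁ ht₁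
  have hsub {t : ℝ} (ht : t ∈ Icc a T) (j k : Fin N) : ‖x j t - x k t‖ ≤ 2 * M :=
    (norm_sub_le _ _).trans (by linarith [hxM j t ht, hxM k t ht])
  refine le_gronwallBound_of_deriv_right_le (g := fun t => ∑ j, ∑ k, ‖x j t - x k t‖ ^ 2)
    (continuousOn_finsetSum _ fun j _ => continuousOn_finsetSum _ fun k _ =>
      ((hx j).sub (hx k)).norm.pow 2)
    (fun t ht => HasDerivWithinAt.fun_sum fun j _ => HasDerivWithinAt.fun_sum fun k _ =>
      ((hx' j t ht).fun_sub (hx' k t ht)).norm_sq) ?_ (fun t ht => ?_) t₁ ht₁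
  · have haT : a ∈ Icc a T := ⟨le_rfl, ht₁.1.trans ht₁.2⟩
    calc ∑ j, ∑ k, ‖x j a - x k a‖ ^ 2 ≤ ∑ _j : Fin N, ∑ _k : Fin N, (2 * M) ^ 2 := by
          gcongr with j _ k _
          exact hsub haT j k
      _ = 4 * N ^ 2 * M ^ 2 := by simp; ring
  · have ht' : t ∈ Icc a T := ⟨ht.1, ht.2.le⟩
    have h1 : ∑ j, ∑ k, inner ℝ (x j t - x k t) (b j t - b k t) ≤ 4 * N ^ 2 * M * K :=
      calc ∑ j, ∑ k, inner ℝ (x j t - x k t) (b j t - b k t)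
          ≤ ∑ _j : Fin N, ∑ _k : Fin N, (2 * M) * (2 * K) := by
            gcongr with j _ k _
            refine (real_inner_le_norm _ _).trans (mul_le_mul (hsub ht' j k) ?_
              (norm_nonneg _) (by positivity))
            exact (norm_sub_le _ _).trans (by linarith [hbK j t ht', hbK k t ht'])
        _ = 4 * N ^ 2 * M * K := by simp; ring
    have h2 := sum_sum_inner_sub (x · t) (cycleLaplacian (x · t))
    rw [sum_cycleLaplacian, inner_zero_right, mul_zero, sub_zero, sum_inner_cycleLaplacian] at h2
    -- The coupling contributes `-(2 lam)(2 N)` times the edge energy; dividing by the Poincaré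
    -- constant `N⁴` gives the rate `4 lam / N³`.
    have h3 : 4 / N ^ 3 * lam * ∑ j, ∑ k, ‖x j t - x k t‖ ^ 2 ≤
        4 * N * lam * ∑ j, ‖x j t - x (j + 1) t‖ ^ 2 :=
      calc _ ≤ 4 / N ^ 3 * lam * ((N : ℝ) ^ 4 * ∑ j, ‖x j t - x (j + 1) t‖ ^ 2) := by
            gcongr
            exact sum_sum_norm_sub_sq_le (x · t)
        _ = _ := by field_simp
    have h4 : ∑ j, ∑ k, 2 * inner ℝ (x j t - x k t)
          (b j t + lam • cycleLaplacian (x · t) j - (b k t + lam • cycleLaplacian (x · t) k)) =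
        2 * ∑ j, ∑ k, inner ℝ (x j t - x k t) (b j t - b k t) +
          2 * lam * ∑ j, ∑ k, inner ℝ (x j t - x k t)
            (cycleLaplacian (x · t) j - cycleLaplacian (x · t) k) := by
      simp only [Finset.mul_sum, ← Finset.sum_add_distrib]
      refine Finset.sum_congr rfl fun j _ => Finset.sum_congr rfl fun k _ => ?_
      rw [add_sub_add_comm, ← smul_sub, inner_add_right, inner_smul_right]
      ring
    rw [h4, h2]
    linarith

end Cycle

/-! ### Strong coupling limit -/

/-- The Grönwall bound with damping `κ lam` tends to zero as `lam → ∞`, uniformly for times bounded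
away from zero. -/
theorem eventually_gronwallBound_neg_mul_lt {δ ε κ τ η : ℝ} (hδ : 0 ≤ δ) (hε : 0 ≤ ε) (hκ : 0 < κ)
    (hτ : 0 < τ) (hη : 0 < η) :
    ∀ᶠ lam : ℝ in atTop, ∀ t, τ ≤ t → gronwallBound δ (-(κ * lam)) ε t < η := by
  have h1 : Tendsto (fun lam : ℝ => κ * lam) atTop atTop := tendsto_id.const_mul_atTop hκ
  -- The transient at the earliest time `τ`, plus the equilibrium level of forcing against damping.
  have h2 : Tendsto (fun lam : ℝ => δ * Real.exp (-(κ * lam * τ)) + ε / (κ * lam)) atTop (𝓝 0) := by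
    have h3 := (Real.tendsto_exp_neg_atTop_nhds_zero.comp (h1.atTop_mul_const hτ)).const_mul δ
    simpa using h3.add (h1.const_div_atTop ε)
  filter_upwards [h2.eventually_lt_const hη, eventually_gt_atTop 0] with lam hlam hpos t ht
  have hk : 0 < κ * lam := by positivity
  rw [gronwallBound_of_K_ne_0 (neg_ne_zero.2 hk.ne')]
  refine lt_of_le_of_lt ?_ hlam
  have h4 : ε / -(κ * lam) * (Real.exp (-(κ * lam) * t) - 1) =
      ε / (κ * lam) - ε / (κ * lam) * Real.exp (-(κ * lam) * t) := by
    rw [div_neg]; ring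
  have h5 : 0 ≤ ε / (κ * lam) * Real.exp (-(κ * lam) * t) := by positivity
  have h6 : Real.exp (-(κ * lam) * t) ≤ Real.exp (-(κ * lam * τ)) := by
    rw [neg_mul]; gcongr
  have h7 := mul_le_mul_of_nonneg_left h6 hδ
  simp only
  rw [h4]
  linarith

/-- The dissipative forcing pairs with the state up to a bounded error. -/
theorem OneSidedDissipative.inner_forcing_le {d : ℕ}
    {f : EuclideanSpace ℝ (Fin d) → EuclideanSpace ℝ (Fin d)} {l : ℝ} (hl : 4 < l)
    (hf : OneSidedDissipative f l) {y z : EuclideanSpace ℝ (Fin d)} {A B : ℝ}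
    (hz : ‖z‖ ≤ B) (hfz : ‖f z‖ ≤ A) :
    inner ℝ y (f (y + z) + y + z) ≤ (A + B) ^ 2 := by
  have h1 := hf (y + z) z
  rw [add_sub_cancel_right, inner_sub_right] at h1
  have h2 : inner ℝ y (f z) ≤ ‖y‖ * A := (real_inner_le_norm _ _).trans (by gcongr)
  have h3 : inner ℝ y z ≤ ‖y‖ * B := (real_inner_le_norm _ _).trans (by gcongr)
  rw [inner_add_right, inner_add_right, real_inner_self_eq_norm_sq]
  -- The pairing is at most `(1 - l) ‖y‖² + (A + B) ‖y‖`; Young's inequality absorbs the linear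
  -- term.
  nlinarith [sq_nonneg ‖y‖, sq_nonneg (‖y‖ - (A + B))]

/-- Synchronization of the ring of coupled equations driven by locally bounded paths, as the
coupling strength tends to infinity. -/
theorem tendstoUniformlyOn_norm_sub_of_isCoupledSolution {N d : ℕ} [NeZero N]
    {f : Fin N → EuclideanSpace ℝ (Fin d) → EuclideanSpace ℝ (Fin d)} {l : ℝ} (hl : 4 < l)
    (hf : ∀ j, OneSidedDissipative (f j) l) {X : Fin N → ℝ → EuclideanSpace ℝ (Fin d)}
    {t₀ T₁ T₂ : ℝ} (hX : ∀ j, ∃ C : ℝ, 0 ≤ C ∧ ∀ t ∈ Icc t₀ T₂, ‖X j t‖ ≤ C)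
    {x : ℝ → Fin N → ℝ → EuclideanSpace ℝ (Fin d)}
    (hx : ∀ lam : ℝ, 0 < lam → IsCoupledSolution f X lam t₀ (x lam))
    (hx₀ : ∃ R : ℝ, ∀ᶠ lam : ℝ in atTop, ∀ j, ‖x lam j t₀‖ ≤ R) (hT : t₀ < T₁) (j k : Fin N) :
    TendstoUniformlyOn (fun lam t => ‖x lam j t - x lam k t‖) (fun _ => 0) atTop (Icc T₁ T₂) := by
  have hN : (0 : ℝ) < N := Nat.cast_pos.2 (NeZero.pos N)
  rcases lt_or_ge T₂ t₀ with hT₂ | hT₂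
  · rw [Icc_eq_empty (by linarith)]
    exact tendstoUniformlyOn_empty
  choose BX hBX0 hBX using hX
  obtain ⟨B, hB⟩ : ∃ B, ∀ j, BX j ≤ B := Finite.exists_le BX
  have hB0 : 0 ≤ B := (hBX0 j).trans (hB j)
  have hXB (j : Fin N) (t : ℝ) (ht : t ∈ Icc t₀ T₂) : ‖X j t‖ ≤ B := (hBX j t ht).trans (hB j)
  have hfbound {r : ℝ} (hr : 0 ≤ r) : ∃ A : ℝ, 0 ≤ A ∧ ∀ j y, ‖y‖ ≤ r → ‖f j y‖ ≤ A := by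
    choose A' hA'0 hA' using fun j => (hf j).exists_norm_le (by linarith) hr
    obtain ⟨A, hA⟩ := Finite.exists_le A'
    exact ⟨A, (hA'0 j).trans (hA j), fun i y hy => (hA' i y hy).trans (hA i)⟩
  obtain ⟨A, hA0, hA⟩ := hfbound hB0
  obtain ⟨R, hR⟩ := hx₀
  -- The linear energy bound evaluated at `T₂`. Here `A` bounds `f` along the driving paths only;
  -- `A₂` below bounds it along the solutions, on the ball of radius `M + B`.
  set M : ℝ := √(N * R ^ 2 + 2 * N * (A + B) ^ 2 * (T₂ - t₀)) with hMdef
  have hM0 : 0 ≤ M := Real.sqrt_nonneg _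
  obtain ⟨A₂, hA₂0, hA₂⟩ := hfbound (add_nonneg hM0 hB0)
  rw [Metric.tendstoUniformlyOn_iff]
  intro ε hε
  filter_upwards [hR, eventually_gt_atTop 0, eventually_gronwallBound_neg_mul_lt
    (δ := 4 * N ^ 2 * M ^ 2) (ε := 8 * N ^ 2 * M * (A₂ + M + B)) (κ := 4 / N ^ 3) (by positivity)
    (by positivity) (by positivity) (sub_pos.2 hT) (pow_pos hε 2)] with lam hlamR hlam hlamε t ht
  have ht₀ : t ∈ Icc t₀ T₂ := ⟨hT.le.trans ht.1, ht.2⟩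
  have hcont (j : Fin N) : ContinuousOn (x lam j) (Icc t₀ T₂) :=
    (hx lam hlam j).1.mono Icc_subset_Ici_self
  have hderiv (j : Fin N) (t : ℝ) (ht : t ∈ Ico t₀ T₂) := (hx lam hlam j).2 t ht.1
  have hxM (j : Fin N) (t : ℝ) (ht : t ∈ Icc t₀ T₂) : ‖x lam j t‖ ≤ M := by
    have h := sum_norm_sq_le_of_inner_le
      (b := fun j t => f j (x lam j t + X j t) + x lam j t + X j t) hlam.le hcont hderiv
      (fun j t ht => (hf j).inner_forcing_le hl (hXB j t ⟨ht.1, ht.2.le⟩)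
        (hA j _ (hXB j t ⟨ht.1, ht.2.le⟩))) t ht
    have h1 : ∑ j, ‖x lam j t₀‖ ^ 2 ≤ N * R ^ 2 := by
      refine (Finset.sum_le_sum fun j _ => pow_le_pow_left₀ (norm_nonneg _) (hlamR j) 2).trans ?_
      simp
    have h2 : 2 * N * (A + B) ^ 2 * (t - t₀) ≤ 2 * N * (A + B) ^ 2 * (T₂ - t₀) := by
      have := ht.2
      gcongr
    have h3 := Finset.single_le_sum (f := fun j => ‖x lam j t‖ ^ 2)
      (fun j _ => by positivity) (Finset.mem_univ j)
    exact Real.le_sqrt_of_sq_le (by linarith)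
  have hq := sum_sum_norm_sub_sq_le_of_norm_le
    (b := fun j t => f j (x lam j t + X j t) + x lam j t + X j t) (K := A₂ + M + B)
    hlam hM0 hcont hderiv hxM (fun j t ht => (norm_add₃_le).trans <| add_le_add_three
      (hA₂ j _ ((norm_add_le _ _).trans (add_le_add (hxM j t ht) (hXB j t ht))))
      (hxM j t ht) (hXB j t ht)) t ht₀
  have h1 : ‖x lam j t - x lam k t‖ ^ 2 ≤ ∑ j, ∑ k, ‖x lam j t - x lam k t‖ ^ 2 :=
    (Finset.single_le_sum (f := fun k => ‖x lam j t - x lam k t‖ ^ 2)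
      (fun k _ => by positivity) (Finset.mem_univ k)).trans
    (Finset.single_le_sum (f := fun j => ∑ k, ‖x lam j t - x lam k t‖ ^ 2)
      (fun j _ => by positivity) (Finset.mem_univ j))
  have h2 := (h1.trans hq).trans_lt (hlamε (t - t₀) (by linarith [ht.1]))
  rw [dist_zero_left, norm_norm]
  exact lt_of_pow_lt_pow_left₀ 2 hε.le h2

theorem mainTheorem3 {Ω : Type*} [MeasurableSpace Ω] (P : Measure Ω) [IsProbabilityMeasure P]
    (N d : ℕ) [NeZero N]
    (L : Fin N → ℝ → Ω → ℝ)
    (hL : ∀ j, IsTwoSidedLevyProcess (L j) P)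
    (hL_indep : iIndepFun (fun (j : Fin N) (ω : Ω) (t : ℝ) => L j t ω) P)
    (hL_int : ∀ j, Integrable (L j 1) P)
    (c : Fin N → EuclideanSpace ℝ (Fin d))
    (f : Fin N → EuclideanSpace ℝ (Fin d) → EuclideanSpace ℝ (Fin d))
    (l : ℝ) (hl : 4 < l) (hf_diss : ∀ j, OneSidedDissipative (f j) l)
    (m₀ : ℝ) (hm₀ : 0 < m₀) (hf_int : ∀ j, IntegrabilityCondition (f j) m₀)
    (t₀ : ℝ) (x : ℝ → Fin N → ℝ → Ω → EuclideanSpace ℝ (Fin d))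
    (hx : ∀ᵐ ω ∂P, ∀ lam : ℝ, 0 < lam →
      IsCoupledSolution f (fun j t => ouProcess (c j) (L j) t ω) lam t₀ (fun j t => x lam j t ω))
    (hx₀ : ∀ᵐ ω ∂P, ∃ R : ℝ, ∀ᶠ lam : ℝ in atTop, ∀ j, ‖x lam j t₀ ω‖ ≤ R) :
    ∀ᵐ ω ∂P, ∀ T₁ T₂ : ℝ, t₀ < T₁ → ∀ j k : Fin N,
      TendstoUniformlyOn (fun (lam t : ℝ) => ‖x lam j t ω - x lam k t ω‖) (fun _ => 0) atTop
        (Icc T₁ T₂) := by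
  -- The exceptional null set is fixed before `T₁`, `T₂`, `j` and `k` are chosen.
  filter_upwards [hx, hx₀, ae_all_iff.2 fun j => (hL j).cadlag] with ω hω hω₀ hcad T₁ T₂ hT j k
  exact tendstoUniformlyOn_norm_sub_of_isCoupledSolution hl hf_diss
    (fun j => exists_norm_ornsteinUhlenbeck_le (c j) (hcad j) t₀ T₂) hω hω₀ hT j k
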